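/- Let $\mathbb K$ be $\mathbb R$ or $\mathbb C$; subsets of $\mathbb C^n$ are called semialgebraic if they are semialgebraic in $\mathbb R^{2n}$. **Locally $\mathbb K$-Nash groups.** A $\mathbb K$-Nash map is an analytic map $F:U\to\mathbb K^m$ on an open semialgebraic set $U\subseteq\mathbb K^n$ each of whose components $F_i$ satisfies $P_i(x,F_i(x))=0$ on $U$ for some polynomial $P_i\in\mathbb K[X_1,\dots,X_n,Y]$ of positive degree in $Y$. A $\mathbb K$-Nash atlas is an analytic atlas whose charts have semialgebraic images and whose changes of charts are $\mathbb K$-Nash maps. A continuous map between manifolds with $\mathbb K$-Nash atlases is locally $\mathbb K$-Nash if near every point it is a $\mathbb K$-Nash map in charts. A locally $\mathbb K$-Nash group is a group with a $\mathbb K$-Nash atlas for which multiplication and inversion are locally $\mathbb K$-Nash. An isomorphism of such groups is a group isomorphism that is locally $\mathbb K$-Nash together with its inverse. **The groups $(\mathbb K^n,+,f)$.** A $\mathbb C$-meromorphic map $f:\mathbb C^n\dashrightarrow\mathbb C^n$ is a meromorphic map, that is, a tuple of quotients $f_j=g_j/h_j$ of entire functions with $h_j\not\equiv 0$; it is $\mathbb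 R$-meromorphic if moreover $\overline{f(\overline u)}=f(u)$. The map $f$ admits an algebraic addition theorem (over $\mathbb K$) if $f_1,\dots,f_n$ are algebraically independent over $\mathbb K$ and every component of $f(u+v)$ is algebraic over $\mathbb K(f_1(u),\dots,f_n(u),f_1(v),\dots,f_n(v))$. We say that $(\mathbb K^n,+,f)$ is a locally $\mathbb K$-Nash group if $f$ is $\mathbb K$-meromorphic, admits an algebraic addition theorem, and there are $a\in\mathbb K^n$ and an open neighbourhood $V\subseteq\mathbb K^n$ of $0$ such that $\varphi:V\to\mathbb K^n$, $u\mapsto f(u+a)$, is an analytic diffeomorphism onto an open subset of $\mathbb K^n$ and $(\mathbb K^n,+)$ with the atlas of translates $\{(c+V,\ u\mapsto\varphi(u-c)):c\in\mathbb K^n\}$ is a locally $\mathbb K$-Nash group; $(\mathbb K^n,+,f)$ denotes this group, for any such choice of $a$ and $V$. **The period group.** For $f=(g_1/h_1,\dots,g_n/h_n)$ let $$\Lambda_f=\{a\in\mathbb C^n:\ g_j(b)h_j(b+a)=h_j(b)g_j(b+a)\ \text{ for all } b\in\mathbb C^n \text{ and all } j\},$$ the group of all $a\in\mathbb C^n$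 with $f(u+a)=f(u)$. **Proposition.** Let $(\mathbb K^n,+,f)$ and $(\mathbb K^n,+,g)$ be locally $\mathbb K$-Nash groups. If they are isomorphic as locally $\mathbb K$-Nash groups, then $\Lambda_f$ and $\Lambda_g$ are discrete subgroups of $\mathbb C^n$, and $$\operatorname{rank}_{\mathbb Z}\Lambda_f=\operatorname{rank}_{\mathbb Z}\Lambda_g .$$ So the rank of the period group is an invariant of the isomorphism class of $(\mathbb K^n,+,f)$. -/

import Mathlib

open Set Topology

noncomputable section

/-! Throughout, `𝕜` is `ℝ` or `ℂ` (the type class `RCLike`), and affine space `𝕜ⁿ` is `ι → 𝕜` for a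
finite index type `ι`. -/

/-! ### Semialgebraic sets and Nash maps -/

/-- The real coordinates (real parts, imaginary parts) of a point of `𝕜^ι`.
For `𝕜 = ℝ` the imaginary parts are all zero. -/
def realCoords {𝕜 : Type*} [RCLike 𝕜] {ι : Type*} (x : ι → 𝕜) : ι ⊕ ι → ℝ :=
  Sum.elim (fun i => RCLike.re (x i)) (fun i => RCLike.im (x i))

/-- Semialgebraic subsets of `𝕜^ι`: the Boolean algebra of sets generated by the sets `{p > 0}`,
where `p` is a real polynomial in the real coordinates. -/
inductive IsSemialgebraic {𝕜 : Type*} [RCLike 𝕜] {ι : Type*} : Set (ι → 𝕜) → Prop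
  | pos (p : MvPolynomial (ι ⊕ ι) ℝ) :
      IsSemialgebraic {x | 0 < MvPolynomial.eval (realCoords x) p}
  | compl {s : Set (ι → 𝕜)} : IsSemialgebraic s → IsSemialgebraic sᶜ
  | inter {s t : Set (ι → 𝕜)} : IsSemialgebraic s → IsSemialgebraic t → IsSemialgebraic (s ∩ t)

/-- `f` is algebraic over `𝕜(g) = 𝕜(gᵢ : i ∈ σ)` on `W`: there is a polynomial `P(X, Y)` over `𝕜`, of
positive degree in `Y`, with `P(g(w), f(w)) = 0` for all `w ∈ W`. The functions take values in a
ring `R`, and `κ` maps the scalars `𝕜` into `R`. -/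
def IsAlgebraicOver {𝕜 R X σ : Type*} [CommRing 𝕜] [CommRing R] (κ : 𝕜 →+* R)
    (g : X → σ → R) (f : X → R) (W : Set X) : Prop :=
  ∃ P : Polynomial (MvPolynomial σ 𝕜), 0 < P.natDegree ∧
    ∀ w ∈ W, P.eval₂ (MvPolynomial.eval₂Hom κ (g w)) (f w) = 0

/-- `f : U → 𝕜^τ`, with `U ⊆ 𝕜^ι`, is a `𝕜`-Nash map: `U` is open and semialgebraic, and `f` is
analytic on `U` and algebraic over `𝕜(id)` on `U`. (Only the values of `f` on `U` matter.) -/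
structure IsNashMap (𝕜 : Type*) [RCLike 𝕜] {ι τ : Type*} [Fintype ι] [Fintype τ]
    (f : (ι → 𝕜) → (τ → 𝕜)) (U : Set (ι → 𝕜)) : Prop where
  isOpen : IsOpen U
  semialgebraic : IsSemialgebraic U
  analytic : AnalyticOnNhd 𝕜 f U
  algebraic : ∀ j, IsAlgebraicOver (RingHom.id 𝕜) (fun x : ι → 𝕜 => x) (fun x => f x j) U

/-! ### Locally Nash manifolds, maps and groups -/

/-- Two charts are `𝕜`-Nash compatible: their images are semialgebraic, and either their domains are
disjoint or the change of charts `ψ φ⁻¹` is a `𝕜`-Nash map and an analytic diffeomorphism. -/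
def NashCompatible {𝕜 : Type*} [RCLike 𝕜] {ι : Type*} [Fintype ι] {M : Type*} [TopologicalSpace M]
    (φ ψ : OpenPartialHomeomorph M (ι → 𝕜)) : Prop :=
  IsSemialgebraic φ.target ∧ IsSemialgebraic ψ.target ∧
    (φ.source ∩ ψ.source = ∅ ∨
      (IsNashMap 𝕜 (fun x => ψ (φ.symm x)) (φ '' (φ.source ∩ ψ.source)) ∧
        AnalyticOnNhd 𝕜 (fun x => φ (ψ.symm x)) (ψ '' (φ.source ∩ ψ.source))))

/-- A family of charts of `M` is a `𝕜`-Nash atlas: it covers `M`, and any two of its charts are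
`𝕜`-Nash compatible. -/
def IsNashAtlas {𝕜 : Type*} [RCLike 𝕜] {ι : Type*} [Fintype ι] {M : Type*} [TopologicalSpace M]
    (A : Set (OpenPartialHomeomorph M (ι → 𝕜))) : Prop :=
  (∀ x, ∃ φ ∈ A, x ∈ φ.source) ∧ ∀ φ ∈ A, ∀ ψ ∈ A, NashCompatible φ ψ

/-- `f : M → N` is a locally `𝕜`-Nash map for the atlases `A` of `M` and `B` of `N`. -/
def IsLocallyNashMap {𝕜 : Type*} [RCLike 𝕜] {ι τ : Type*} [Fintype ι] [Fintype τ]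
    {M N : Type*} [TopologicalSpace M] [TopologicalSpace N]
    (A : Set (OpenPartialHomeomorph M (ι → 𝕜))) (B : Set (OpenPartialHomeomorph N (τ → 𝕜)))
    (f : M → N) : Prop :=
  Continuous f ∧ ∀ a, ∀ ψ ∈ B, f a ∈ ψ.source →
    ∃ φ ∈ A, ∃ U : Set M, IsOpen U ∧ U ⊆ φ.source ∧ a ∈ U ∧ MapsTo f U ψ.source ∧
      IsNashMap 𝕜 (fun x => ψ (f (φ.symm x))) (φ '' U)

/-- The product atlas on `M × N`, with `𝕜^ι × 𝕜^τ` identified with `𝕜^(ι ⊕ τ)`. -/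
def prodAtlas {𝕜 : Type*} [RCLike 𝕜] {ι τ : Type*} {M N : Type*} [TopologicalSpace M]
    [TopologicalSpace N] (A : Set (OpenPartialHomeomorph M (ι → 𝕜)))
    (B : Set (OpenPartialHomeomorph N (τ → 𝕜))) :
    Set (OpenPartialHomeomorph (M × N) (ι ⊕ τ → 𝕜)) :=
  {χ | ∃ φ ∈ A, ∃ ψ ∈ B,
    χ = (φ.prod ψ).transHomeomorph Homeomorph.sumArrowHomeomorphProdArrow.symm}

/-- The (additively written) group `G` with the atlas `A` is a locally `𝕜`-Nash group: `A` is a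
`𝕜`-Nash atlas and the group operations are locally `𝕜`-Nash maps. -/
structure IsLocallyNashGroup {𝕜 : Type*} [RCLike 𝕜] {ι : Type*} [Fintype ι] {G : Type*}
    [TopologicalSpace G] [AddGroup G] (A : Set (OpenPartialHomeomorph G (ι → 𝕜))) : Prop where
  isNashAtlas : IsNashAtlas A
  add : IsLocallyNashMap (prodAtlas A A) A (fun p : G × G => p.1 + p.2)
  neg : IsLocallyNashMap A A (fun x : G => -x)

/-- The locally `𝕜`-Nash groups `(G, A)` and `(H, B)` are isomorphic: there is an isomorphism of
groups `G → H` which is locally `𝕜`-Nash together with its inverse. -/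
def LocallyNashIsomorphic {𝕜 : Type*} [RCLike 𝕜] {ι τ : Type*} [Fintype ι] [Fintype τ]
    {G H : Type*} [TopologicalSpace G] [AddGroup G] [TopologicalSpace H] [AddGroup H]
    (A : Set (OpenPartialHomeomorph G (ι → 𝕜))) (B : Set (OpenPartialHomeomorph H (τ → 𝕜))) : Prop :=
  ∃ α : G ≃+ H, IsLocallyNashMap A B α ∧ IsLocallyNashMap B A α.symm

/-- The atlas `{(g + U, u ↦ φ(-g + u)) : g ∈ G}` of translates of a chart `(U, φ)` of `G`. -/
def translateAtlas {𝕜 : Type*} [RCLike 𝕜] {ι : Type*} {G : Type*} [TopologicalSpace G] [AddGroup G]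
    [IsTopologicalAddGroup G] (φ : OpenPartialHomeomorph G (ι → 𝕜)) :
    Set (OpenPartialHomeomorph G (ι → 𝕜)) :=
  Set.range fun g : G => (Homeomorph.addLeft (-g)).transOpenPartialHomeomorph φ

/-! ### Meromorphic maps -/

/-- The embedding of `𝕜` into `ℂ` (the inclusion for `𝕜 = ℝ`, the identity for `𝕜 = ℂ`). -/
def toComplex (𝕜 : Type*) [RCLike 𝕜] : 𝕜 →+* ℂ where
  toFun z := (RCLike.re z : ℂ) + (RCLike.im z : ℂ) * Complex.I
  map_one' := by simp
  map_zero' := by simp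
  map_add' z w := by
    apply Complex.ext <;> simp
  map_mul' z w := by
    apply Complex.ext <;> simp [RCLike.mul_re, RCLike.mul_im]

/-- A presentation `(g₁/h₁, …, gₘ/hₘ)` of a meromorphic map `ℂⁿ ⇢ ℂᵐ`, with `gⱼ, hⱼ` holomorphic on
`ℂⁿ` and `hⱼ` not identically zero. All notions below depend only on the meromorphic functions
`gⱼ/hⱼ`, not on the choice of numerators and denominators. -/
structure MeromorphicMap (n m : ℕ) where
  num : Fin m → (Fin n → ℂ) → ℂ
  den : Fin m → (Fin n → ℂ) → ℂ
  analytic_num : ∀ j, AnalyticOnNhd ℂ (num j) univ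
  analytic_den : ∀ j, AnalyticOnNhd ℂ (den j) univ
  den_ne_zero : ∀ j, den j ≠ 0

namespace MeromorphicMap

variable {n m : ℕ}

/-- The dense open set on which all the denominators are nonzero. -/
def dom (f : MeromorphicMap n m) : Set (Fin n → ℂ) := {u | ∀ j, f.den j u ≠ 0}

/-- The value of `f` at `u` (meaningful for `u ∈ f.dom`). -/
def val (f : MeromorphicMap n m) (u : Fin n → ℂ) : Fin m → ℂ := fun j => f.num j u / f.den j u

/-- `f` is invariant: `conj (f (conj u)) = f u`, as meromorphic maps. -/
def IsInvariant (f : MeromorphicMap n m) : Prop :=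
  ∀ j u, star (f.num j (star u)) * f.den j u = f.num j u * star (f.den j (star u))

/-- `f` is `𝕜`-meromorphic: no condition for `𝕜 = ℂ`, and invariant for `𝕜 = ℝ`
(the case in which the element `I` of the class `RCLike` is zero). -/
def IsKMeromorphic (𝕜 : Type*) [RCLike 𝕜] (f : MeromorphicMap n m) : Prop :=
  (RCLike.I : 𝕜) = 0 → f.IsInvariant

/-- `f : ℂⁿ ⇢ ℂⁿ` admits an algebraic addition theorem over `𝕜`: its coordinate functions are
algebraically independent over `𝕜`, and the coordinates of `f(u + v)` are algebraic over
`𝕜(f(u), f(v))`. -/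
def AdmitsAAT (𝕜 : Type*) [RCLike 𝕜] (f : MeromorphicMap n n) : Prop :=
  (∀ P : MvPolynomial (Fin n) 𝕜,
    (∀ u ∈ f.dom, MvPolynomial.eval₂ (toComplex 𝕜) (f.val u) P = 0) → P = 0) ∧
  ∀ i, IsAlgebraicOver (toComplex 𝕜)
    (fun p : (Fin n → ℂ) × (Fin n → ℂ) => Sum.elim (f.val p.1) (f.val p.2))
    (fun p => f.val (p.1 + p.2) i)
    {p | p.1 ∈ f.dom ∧ p.2 ∈ f.dom ∧ p.1 + p.2 ∈ f.dom}

/-- The chart `φ` of `𝕜ⁿ` at `0` is induced by `f`: for some `a ∈ 𝕜ⁿ`, it is given by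
`φ(u) = f(u + a)`, and it is an analytic diffeomorphism from an open neighbourhood of `0` onto an
open subset of `𝕜ⁿ`. (As `φ` is analytic, the equation with cleared denominators says that the
meromorphic map `f(· + a)` is analytic near the domain of `φ`, where it takes the values `φ(u)`.) -/
def InducesChart {𝕜 : Type*} [RCLike 𝕜] (f : MeromorphicMap n n)
    (φ : OpenPartialHomeomorph (Fin n → 𝕜) (Fin n → 𝕜)) : Prop :=
  0 ∈ φ.source ∧ AnalyticOnNhd 𝕜 φ φ.source ∧ AnalyticOnNhd 𝕜 φ.symm φ.target ∧
    ∃ a : Fin n → 𝕜, ∀ u ∈ φ.source, ∀ j,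
      toComplex 𝕜 (φ u j) * f.den j (fun i => toComplex 𝕜 ((u + a) i)) =
        f.num j (fun i => toComplex 𝕜 ((u + a) i))

/-- `(𝕜ⁿ, +, f)` is a locally `𝕜`-Nash group, realised by the chart `φ`: `f` is a `𝕜`-meromorphic
map which admits an algebraic addition theorem, `φ` is a chart of `𝕜ⁿ` at `0` of the form
`u ↦ f(u + a)`, and `𝕜ⁿ` with the atlas of translates of `φ` is a locally `𝕜`-Nash group. -/
structure GivesLocallyNashGroup {𝕜 : Type*} [RCLike 𝕜] (f : MeromorphicMap n n)
    (φ : OpenPartialHomeomorph (Fin n → 𝕜) (Fin n → 𝕜)) : Prop where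
  isKMeromorphic : f.IsKMeromorphic 𝕜
  admitsAAT : f.AdmitsAAT 𝕜
  inducesChart : f.InducesChart φ
  isLocallyNashGroup : IsLocallyNashGroup (translateAtlas φ)

/-- A product of entire functions vanishes only if a factor does; used for the periods below. -/
theorem eq_zero_of_mul_eq_zero {F d : (Fin n → ℂ) → ℂ} (hF : AnalyticOnNhd ℂ F univ)
    (hd : AnalyticOnNhd ℂ d univ) (hd0 : d ≠ 0) (h : ∀ u, F u * d u = 0) : F = 0 := by
  obtain ⟨x, hx⟩ := Function.ne_iff.mp hd0
  have hev : ∀ᶠ u in 𝓝 x, d u ≠ 0 := (hd x (mem_univ x)).continuousAt.eventually_ne hx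
  refine AnalyticOnNhd.eq_of_eventuallyEq (z₀ := x) hF (fun _ _ => analyticAt_const) ?_
  filter_upwards [hev] with u hu
  exact (mul_eq_zero.mp (h u)).resolve_right hu

/-- The group of periods of `f`: all `a ∈ ℂⁿ` with `f(u) = f(u + a)` as meromorphic maps. -/
def periods (f : MeromorphicMap n m) : AddSubgroup (Fin n → ℂ) where
  carrier := {a | ∀ j b, f.num j b * f.den j (b + a) = f.den j b * f.num j (b + a)}
  zero_mem' := by
    intro j b
    simp [mul_comm]
  neg_mem' := by
    intro a ha j b
    have h := ha j (b + -a)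
    simp only [neg_add_cancel_right] at h
    linear_combination -h
  add_mem' := by
    intro a a' ha ha' j
    have shift : ∀ (F : (Fin n → ℂ) → ℂ), AnalyticOnNhd ℂ F univ → ∀ c : Fin n → ℂ,
        AnalyticOnNhd ℂ (fun b => F (b + c)) univ := fun F hF c b _ =>
      (hF (b + c) (mem_univ _)).comp_of_eq (analyticAt_id.add analyticAt_const) rfl
    have key := eq_zero_of_mul_eq_zero
      (F := fun b => f.num j b * f.den j (b + (a + a')) - f.den j b * f.num j (b + (a + a')))
      (d := fun b => f.den j (b + a))
      (((f.analytic_num j).mul (shift _ (f.analytic_den j) _)).sub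
        ((f.analytic_den j).mul (shift _ (f.analytic_num j) _)))
      (shift _ (f.analytic_den j) _)
      (by
        intro h0
        apply f.den_ne_zero j
        funext u
        simpa using congrFun h0 (u - a))
      (by
        intro b
        have h1 := ha j b
        have h2 := ha' j (b + a)
        simp only [add_assoc] at h2
        linear_combination f.den j (b + (a + a')) * h1 + f.den j b * h2)
    intro b
    have := congrFun key b
    simpa [sub_eq_zero] using this

end MeromorphicMap

end

/-!
The periods `Λ_f` are discrete because `f` is a local diffeomorphism somewhere: the differential of
the chart `φ` at a suitable point of `𝕜ⁿ` is invertible, its complexification is the differential of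
`f`, so `f` is injective near a point of `ℂⁿ`, and small translations cannot be periods
(`MeromorphicMap.InducesChart.discreteTopology_periods`).

A locally Nash isomorphism `α` is additive, continuous and `𝕜`-differentiable at `0`, hence `𝕜`-linear
(`IsLocallyNashMap.exists_linearMap`); it extends to an automorphism `complexify L` of `ℂⁿ`. In the
charts `φ` and `ψ`, that `α` is Nash near `0` means that the coordinates of `g (α u + a')` are
algebraic over `𝕜(f(u + s))` for some translations `a'` and `s`. Translating a map does not change
its periods, so the ranks are compared by the following fact
(`MeromorphicMap.exists_nsmul_mem_periods`). Let `F`, `G` be meromorphic on `ℂⁿ` with `P(F, Gⱼ) = 0`,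
where `P(F, Y)` is a nonzero polynomial of degree at most `d` (here the algebraic independence of the
coordinates of `f` enters). If `b` is a period of `F`, then the
`d + 1` functions `Gⱼ(u + kb)`, `0 ≤ k ≤ d`, are all roots of `P(F(u), Y)`, so two of them coincide,
and one of `b, 2b, …, db` is a period of `Gⱼ`. Hence a fixed multiple `M` of every period of `F` is a
period of `G`, and `b ↦ M · α(b)` embeds `Λ_f` into `Λ_g`. The same for `α⁻¹` gives equality of ranks.

The argument with roots is made pointwise, after multiplying by denominators, which uses two facts
about entire functions: they form a domain (`MeromorphicMap.exists_eq_zero_of_prod_eq_zero`), and one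
that vanishes on an open subset of `𝕜ⁿ` is zero (`eq_zero_of_complexPoint`).
-/

noncomputable section

/-! ### The embedding of `𝕜ⁿ` into `ℂⁿ` and complexification of linear maps -/

section Complexification

variable {𝕜 : Type*} [RCLike 𝕜] {n : ℕ}

theorem toComplex_injective : Function.Injective (toComplex 𝕜) := (toComplex 𝕜).injective

theorem continuous_toComplex : Continuous (toComplex 𝕜) := by
  change Continuous fun z : 𝕜 => (RCLike.re z : ℂ) + (RCLike.im z : ℂ) * Complex.I
  fun_prop

theorem toComplex_smul (r : ℝ) (z : 𝕜) : toComplex 𝕜 (r • z) = r • toComplex 𝕜 z := by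
  apply Complex.ext <;> simp [toComplex, RCLike.smul_re, RCLike.smul_im]

/-- The embedding of `𝕜ⁿ` into `ℂⁿ`, as a real-linear map. -/
def complexPoint (𝕜 : Type*) [RCLike 𝕜] (n : ℕ) : (Fin n → 𝕜) →L[ℝ] (Fin n → ℂ) where
  toFun u := fun i => toComplex 𝕜 (u i)
  map_add' u v := by ext i; simp
  map_smul' r u := by ext i; simp [toComplex_smul]
  cont := continuous_pi fun i => continuous_toComplex.comp (continuous_apply i)

@[simp] theorem complexPoint_apply (u : Fin n → 𝕜) (i : Fin n) :
    complexPoint 𝕜 n u i = toComplex 𝕜 (u i) := rfl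

theorem complexPoint_injective : Function.Injective (complexPoint 𝕜 n) := fun _ _ h =>
  funext fun i => toComplex_injective (congrFun h i)

/-- The complexification of a `𝕜`-linear endomorphism of `𝕜ⁿ`: the endomorphism of `ℂⁿ` with the
same matrix. -/
def complexify (L : (Fin n → 𝕜) →ₗ[𝕜] (Fin n → 𝕜)) : (Fin n → ℂ) →ₗ[ℂ] (Fin n → ℂ) :=
  Matrix.toLin' ((LinearMap.toMatrix' L).map (toComplex 𝕜))

theorem complexify_complexPoint (L : (Fin n → 𝕜) →ₗ[𝕜] (Fin n → 𝕜)) (u : Fin n → 𝕜) :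
    complexify L (complexPoint 𝕜 n u) = complexPoint 𝕜 n (L u) := by
  ext i
  conv_rhs => rw [complexPoint_apply, ← LinearMap.toMatrix'_mulVec L u]
  simp [complexify, Matrix.toLin'_apply, Matrix.mulVec, dotProduct, map_sum]

theorem complexify_comp (L L' : (Fin n → 𝕜) →ₗ[𝕜] (Fin n → 𝕜)) :
    complexify (L ∘ₗ L') = complexify L ∘ₗ complexify L' := by
  simp [complexify, LinearMap.toMatrix'_comp, Matrix.map_mul, Matrix.toLin'_mul]

theorem complexify_id : complexify (LinearMap.id : (Fin n → 𝕜) →ₗ[𝕜] _) = LinearMap.id := by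
  simp [complexify, LinearMap.toMatrix'_id, Matrix.map_one]

/-- A complex-linear endomorphism of `ℂⁿ` is determined by its restriction to `𝕜ⁿ`. -/
theorem eq_complexify {A : (Fin n → ℂ) →ₗ[ℂ] (Fin n → ℂ)} {L : (Fin n → 𝕜) →ₗ[𝕜] (Fin n → 𝕜)}
    (h : ∀ u, A (complexPoint 𝕜 n u) = complexPoint 𝕜 n (L u)) : A = complexify L := by
  refine LinearMap.pi_ext' fun i => LinearMap.ext_ring ?_
  have e : complexPoint 𝕜 n (Pi.single i 1) = Pi.single i 1 := by
    ext j
    by_cases hj : j = i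
    · subst hj; simp
    · simp [hj]
  have := (h (Pi.single i 1)).trans (complexify_complexPoint L _).symm
  rw [e] at this
  simpa using this

/-- An entire function on `ℂⁿ` which vanishes on a nonempty open subset of `𝕜ⁿ` is zero. -/
theorem eq_zero_of_complexPoint {H : (Fin n → ℂ) → ℂ} (hH : AnalyticOnNhd ℂ H univ)
    {V : Set (Fin n → 𝕜)} (hV : IsOpen V) (hne : V.Nonempty)
    (h0 : ∀ u ∈ V, H (complexPoint 𝕜 n u) = 0) : H = 0 := by
  obtain ⟨u₀, hu₀⟩ := hne
  obtain ⟨ε, hε, hball⟩ := Metric.isOpen_iff.mp hV u₀ hu₀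
  -- The coordinates in `s` are freed from `𝕜` one at a time by the identity theorem on `ℂ`.
  have key : ∀ s : Finset (Fin n), ∀ w : Fin n → ℂ,
      (∀ i ∉ s, w i ∈ toComplex 𝕜 '' Metric.ball (u₀ i) ε) → H w = 0 := by
    intro s
    induction s using Finset.induction_on with
    | empty =>
      intro w hw
      choose u hu huw using fun i => hw i (by simp)
      have : w = complexPoint 𝕜 n u := funext fun i => (huw i).symm
      rw [this]
      refine h0 u (hball ?_)
      rw [Metric.mem_ball, dist_pi_lt_iff hε]
      exact hu
    | insert a s ha ih =>
      intro w hw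
      have han : AnalyticOnNhd ℂ (fun z : ℂ => H (Function.update w a z)) univ := by
        intro z _
        refine (hH _ (mem_univ _)).comp (g := H) (f := fun z : ℂ => Function.update w a z) ?_
        rw [analyticAt_pi_iff]
        intro i
        by_cases hi : i = a
        · subst hi; simpa using! analyticAt_id (𝕜 := ℂ)
        · simpa [hi] using analyticAt_const
      have hz : ∀ z ∈ Metric.ball (u₀ a) ε, H (Function.update w a (toComplex 𝕜 z)) = 0 := by
        intro z hz
        apply ih
        intro i hi
        by_cases hia : i = a
        · subst hia; simpa using ⟨z, hz, rfl⟩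
        · simpa [hia] using hw i (by simp [hia, hi])
      have hfreq : ∃ᶠ z in 𝓝[≠] (toComplex 𝕜 (u₀ a)), H (Function.update w a z) = 0 := by
        have hev : ∃ᶠ z in 𝓝[≠] (u₀ a), z ∈ Metric.ball (u₀ a) ε :=
          (Filter.Eventually.filter_mono nhdsWithin_le_nhds
            (Metric.ball_mem_nhds _ hε)).frequently
        have ht : Filter.Tendsto (toComplex 𝕜) (𝓝[≠] (u₀ a)) (𝓝[≠] (toComplex 𝕜 (u₀ a))) :=
          continuous_toComplex.continuousAt.continuousWithinAt.tendsto_nhdsWithin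
            fun z hz => toComplex_injective.ne hz
        exact ht.frequently (hev.mono hz)
      have := congrFun (AnalyticOnNhd.eq_of_frequently_eq (g := fun _ => 0) han
        (fun _ _ => analyticAt_const) hfreq) (w a)
      simpa using this
  funext w
  exact key Finset.univ w (by simp)

end Complexification

namespace MeromorphicMap

/-! ### Entire functions and cleared denominators -/

section Clearing

variable {n m : ℕ}

/-- A finite product of entire functions on `ℂⁿ` vanishes only if one of the factors does. -/
theorem exists_eq_zero_of_prod_eq_zero {ι : Type*} (s : Finset ι) {F : ι → (Fin n → ℂ) → ℂ}
    (hF : ∀ i, AnalyticOnNhd ℂ (F i) univ) (h : ∀ u, ∏ i ∈ s, F i u = 0) :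
    ∃ i ∈ s, F i = 0 := by
  classical
  induction s using Finset.induction_on with
  | empty => simpa using h 0
  | insert a s ha ih =>
    by_cases h0 : F a = 0
    · exact ⟨a, by simp, h0⟩
    · have hp : (fun u => ∏ i ∈ s, F i u) = 0 :=
        eq_zero_of_mul_eq_zero (Finset.analyticOnNhd_fun_prod _ fun i _ => hF i) (hF a) h0
          fun u => by
            have := h u
            rwa [Finset.prod_insert ha, mul_comm] at this
      obtain ⟨i, hi, h0⟩ := ih (congrFun hp)
      exact ⟨i, by simp [hi], h0⟩

/-- `h`, a function on the set `D ≠ 0`, becomes entire after multiplication by a power of `D`. -/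
def Clearable (D h : (Fin n → ℂ) → ℂ) : Prop :=
  ∃ N : ℕ, ∃ H : (Fin n → ℂ) → ℂ, AnalyticOnNhd ℂ H univ ∧ ∀ u, D u ≠ 0 → H u = D u ^ N * h u

variable {D h h' : (Fin n → ℂ) → ℂ}

theorem Clearable.const (D : (Fin n → ℂ) → ℂ) (c : ℂ) : Clearable D fun _ => c :=
  ⟨0, fun _ => c, fun _ _ => analyticAt_const, fun u _ => by simp⟩

theorem Clearable.add (hD : AnalyticOnNhd ℂ D univ) (h₁ : Clearable D h) (h₂ : Clearable D h') :
    Clearable D fun u => h u + h' u := by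
  obtain ⟨N, H, hH, e⟩ := h₁
  obtain ⟨N', H', hH', e'⟩ := h₂
  refine ⟨N + N', fun u => D u ^ N' * H u + D u ^ N * H' u,
    ((hD.pow _).mul hH).add ((hD.pow _).mul hH'), fun u hu => ?_⟩
  simp only [e u hu, e' u hu]
  ring

theorem Clearable.mul (h₁ : Clearable D h) (h₂ : Clearable D h') :
    Clearable D fun u => h u * h' u := by
  obtain ⟨N, H, hH, e⟩ := h₁
  obtain ⟨N', H', hH', e'⟩ := h₂
  refine ⟨N + N', fun u => H u * H' u, hH.mul hH', fun u hu => ?_⟩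
  simp only [e u hu, e' u hu]
  ring

theorem Clearable.pow (h₁ : Clearable D h) (k : ℕ) : Clearable D fun u => h u ^ k := by
  induction k with
  | zero => simpa using Clearable.const D 1
  | succ k ih => simpa only [pow_succ] using ih.mul h₁

theorem Clearable.div_of_mul_eq {p q r : (Fin n → ℂ) → ℂ} (hp : AnalyticOnNhd ℂ p univ)
    (hr : AnalyticOnNhd ℂ r univ) (hD : ∀ u, D u = q u * r u) :
    Clearable D fun u => p u / q u := by
  refine ⟨1, fun u => p u * r u, hp.mul hr, fun u hu => ?_⟩
  have : q u ≠ 0 := left_ne_zero_of_mul (hD u ▸ hu)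
  rw [hD]
  field_simp

/-- A clearable function which vanishes at the points of `𝕜ⁿ` in a nonempty open set vanishes
wherever `D ≠ 0`. -/
theorem Clearable.eq_zero {𝕜 : Type*} [RCLike 𝕜] (hD : AnalyticOnNhd ℂ D univ) (hD0 : D ≠ 0)
    (hh : Clearable D h) {V : Set (Fin n → 𝕜)} (hV : IsOpen V) (hne : V.Nonempty)
    (h0 : ∀ u ∈ V, D (complexPoint 𝕜 n u) ≠ 0 → h (complexPoint 𝕜 n u) = 0)
    {u : Fin n → ℂ} (hu : D u ≠ 0) : h u = 0 := by
  obtain ⟨N, H, hH, e⟩ := hh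
  have hHD : (fun u => H u * D u) = 0 := by
    refine eq_zero_of_complexPoint (hH.mul hD) hV hne fun v hv => ?_
    by_cases hDv : D (complexPoint 𝕜 n v) = 0
    · simp [hDv]
    · simp [e _ hDv, h0 v hv hDv]
  have hH0 := eq_zero_of_mul_eq_zero hH hD hD0 (congrFun hHD)
  have := e u hu
  rw [hH0] at this
  simpa [hu] using this.symm

theorem clearable_eval₂ {σ R : Type*} [CommRing R] (κ : R →+* ℂ) (hD : AnalyticOnNhd ℂ D univ)
    {F : (Fin n → ℂ) → σ → ℂ} (hF : ∀ i, Clearable D fun u => F u i) (P : MvPolynomial σ R) :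
    Clearable D fun u => MvPolynomial.eval₂ κ (F u) P := by
  induction P using MvPolynomial.induction_on with
  | C a => simpa using Clearable.const D (κ a)
  | add p q hp hq => simpa using hp.add hD hq
  | mul_X p i hp => simpa using hp.mul (hF i)

theorem clearable_polynomial_eval₂ {σ R : Type*} [CommRing R] (κ : R →+* ℂ)
    (hD : AnalyticOnNhd ℂ D univ) {F : (Fin n → ℂ) → σ → ℂ} (hF : ∀ i, Clearable D fun u => F u i)
    {G : (Fin n → ℂ) → ℂ} (hG : Clearable D G) (P : Polynomial (MvPolynomial σ R)) :
    Clearable D fun u => P.eval₂ (MvPolynomial.eval₂Hom κ (F u)) (G u) := by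
  induction P using Polynomial.induction_on' with
  | add p q hp hq => simpa [Polynomial.eval₂_add] using hp.add hD hq
  | monomial k a =>
    simpa [Polynomial.eval₂_monomial] using (clearable_eval₂ κ hD hF a).mul (hG.pow k)

end Clearing

/-! ### Periods of algebraically dependent meromorphic maps -/

section Periods

variable {n m l : ℕ}

theorem analyticOnNhd_add_const {F : (Fin n → ℂ) → ℂ} (hF : AnalyticOnNhd ℂ F univ)
    (c : Fin n → ℂ) : AnalyticOnNhd ℂ (fun u => F (u + c)) univ := fun u _ =>
  (hF (u + c) (mem_univ _)).comp_of_eq (analyticAt_id.add analyticAt_const) rfl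

theorem add_const_ne_zero {F : (Fin n → ℂ) → ℂ} (hF : F ≠ 0) (c : Fin n → ℂ) :
    (fun u => F (u + c)) ≠ 0 := fun h => hF <| funext fun u => by
  simpa using congrFun h (u - c)

/-- The `j`-th coordinate of a meromorphic map. -/
def component (f : MeromorphicMap n m) (j : Fin m) : MeromorphicMap n 1 where
  num _ := f.num j
  den _ := f.den j
  analytic_num _ := f.analytic_num j
  analytic_den _ := f.analytic_den j
  den_ne_zero _ := f.den_ne_zero j

theorem mem_periods_iff_component {f : MeromorphicMap n m} {b : Fin n → ℂ} :
    b ∈ f.periods ↔ ∀ j, b ∈ (f.component j).periods :=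
  ⟨fun h j _ => h j, fun h j => h j 0⟩

theorem val_add_of_mem_periods {f : MeromorphicMap n m} {b u : Fin n → ℂ} (hb : b ∈ f.periods)
    (hu : u ∈ f.dom) (hub : u + b ∈ f.dom) : f.val (u + b) = f.val u := by
  funext j
  have := hb j u
  rw [val, val, div_eq_div_iff (hub j) (hu j)]
  linear_combination -this

/-- If the values of `f` and `g` at the points of `𝕜ⁿ` in an open set satisfy an equation
`P(f, gⱼ) = 0`, where the leading coefficient of `P` does not vanish identically at `f`, then for
every period `b` of `f` one of `b, 2b, …, db` is a period of `gⱼ`, where `d` is the degree of `P`.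
Indeed, the `d + 1` functions `gⱼ(u + kb)` are roots of the same polynomial `P(f(u), Y)`, so two of
them coincide. -/
theorem exists_nsmul_mem_periods {𝕜 : Type*} [RCLike 𝕜] (f : MeromorphicMap n m)
    (g : MeromorphicMap n l) (j : Fin l) (P : Polynomial (MvPolynomial (Fin m) 𝕜))
    (hlc : ∃ u ∈ f.dom, MvPolynomial.eval₂ (toComplex 𝕜) (f.val u) P.leadingCoeff ≠ 0)
    {V : Set (Fin n → 𝕜)} (hV : IsOpen V) (hne : V.Nonempty)
    (hP : ∀ u ∈ V, complexPoint 𝕜 n u ∈ f.dom → g.den j (complexPoint 𝕜 n u) ≠ 0 →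
      P.eval₂ (MvPolynomial.eval₂Hom (toComplex 𝕜) (f.val (complexPoint 𝕜 n u)))
        (g.val (complexPoint 𝕜 n u) j) = 0)
    {b : Fin n → ℂ} (hb : b ∈ f.periods) :
    ∃ k : ℕ, 0 < k ∧ k ≤ P.natDegree ∧ k • b ∈ (g.component j).periods := by
  classical
  set κ := toComplex 𝕜
  set d := P.natDegree
  -- `D` is the product of the denominators of `f`, and `D'` that of all denominators in use.
  let D : (Fin n → ℂ) → ℂ := fun u => ∏ i, f.den i u
  let D' : (Fin n → ℂ) → ℂ := fun u => g.den j u * D u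
  have hD : AnalyticOnNhd ℂ D univ := Finset.analyticOnNhd_fun_prod _ fun i _ => f.analytic_den i
  have hD0 : D ≠ 0 := fun h => by
    obtain ⟨i, -, hi⟩ := exists_eq_zero_of_prod_eq_zero _ f.analytic_den (congrFun h)
    exact f.den_ne_zero i hi
  have hD' : AnalyticOnNhd ℂ D' univ := (g.analytic_den j).mul hD
  have hD'0 : D' ≠ 0 := fun h =>
    hD0 (eq_zero_of_mul_eq_zero hD (g.analytic_den j) (g.den_ne_zero j) fun u => by
      rw [mul_comm]; exact congrFun h u)
  have dom_of_D : ∀ {u}, D u ≠ 0 → u ∈ f.dom := fun hu i => (Finset.prod_ne_zero_iff.mp hu) i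
    (Finset.mem_univ i)
  have D_of_dom : ∀ {u}, u ∈ f.dom → D u ≠ 0 := fun hu => Finset.prod_ne_zero_iff.mpr fun i _ => hu i
  have hfD : ∀ i, Clearable D fun u => f.val u i := fun i =>
    Clearable.div_of_mul_eq (r := fun u => ∏ i' ∈ Finset.univ.erase i, f.den i' u)
      (f.analytic_num i) (Finset.analyticOnNhd_fun_prod _ fun i _ => f.analytic_den i)
      fun u => (Finset.mul_prod_erase _ (fun i => f.den i u) (Finset.mem_univ i)).symm
  have hfD' : ∀ i, Clearable D' fun u => f.val u i := fun i =>
    Clearable.div_of_mul_eq (r := fun u => g.den j u * ∏ i' ∈ Finset.univ.erase i, f.den i' u)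
      (f.analytic_num i) ((g.analytic_den j).mul
        (Finset.analyticOnNhd_fun_prod _ fun i _ => f.analytic_den i))
      fun u => by
        simp only [D', D, ← Finset.mul_prod_erase _ (fun i => f.den i u) (Finset.mem_univ i)]
        ring
  have hgD' : Clearable D' fun u => g.val u j :=
    Clearable.div_of_mul_eq (g.analytic_num j) hD fun u => rfl
  -- By the identity theorem, the equation holds wherever it is meaningful.
  have hPall : ∀ u, D' u ≠ 0 →
      P.eval₂ (MvPolynomial.eval₂Hom κ (f.val u)) (g.val u j) = 0 := fun u hu =>
    (clearable_polynomial_eval₂ κ hD' hfD' hgD' P).eq_zero hD' hD'0 hV hne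
      (fun v hv hDv => hP v hv (dom_of_D (right_ne_zero_of_mul hDv)) (left_ne_zero_of_mul hDv)) hu
  obtain ⟨N, E, hE, hEe⟩ := clearable_eval₂ κ hD hfD P.leadingCoeff
  have hE0 : E ≠ 0 := by
    obtain ⟨u, hu, hlu⟩ := hlc
    intro h
    have := hEe u (D_of_dom hu)
    rw [h] at this
    exact mul_ne_zero (pow_ne_zero N (D_of_dom hu)) hlu this.symm
  let Q : Fin (d + 1) × Fin (d + 1) → (Fin n → ℂ) → ℂ := fun p u =>
    g.num j (u + (p.1 : ℕ) • b) * g.den j (u + (p.2 : ℕ) • b) -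
      g.num j (u + (p.2 : ℕ) • b) * g.den j (u + (p.1 : ℕ) • b)
  let S : Finset (Fin (d + 1) × Fin (d + 1)) := Finset.univ.filter fun p => p.1 < p.2
  have hQ : ∀ p, AnalyticOnNhd ℂ (Q p) univ := fun p =>
    ((analyticOnNhd_add_const (g.analytic_num j) _).mul
      (analyticOnNhd_add_const (g.analytic_den j) _)).sub
    ((analyticOnNhd_add_const (g.analytic_num j) _).mul
      (analyticOnNhd_add_const (g.analytic_den j) _))
  let B : (Fin n → ℂ) → ℂ := fun u => ∏ k : Fin (d + 1), D' (u + (k : ℕ) • b)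
  have hB : AnalyticOnNhd ℂ B univ :=
    Finset.analyticOnNhd_fun_prod _ fun k _ => analyticOnNhd_add_const hD' _
  have hB0 : B ≠ 0 := fun h => by
    obtain ⟨k, -, hk⟩ := exists_eq_zero_of_prod_eq_zero _
      (F := fun (k : Fin (d + 1)) u => D' (u + (k : ℕ) • b))
      (fun k => analyticOnNhd_add_const hD' _) (congrFun h)
    exact add_const_ne_zero hD'0 _ hk
  -- Where nothing degenerates, two of the values `gⱼ(u + kb)` coincide by counting roots.
  have hprod : ∀ u, E u * B u ≠ 0 → ∏ p ∈ S, Q p u = 0 := by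
    intro u hu
    have hDk : ∀ k : Fin (d + 1), D' (u + (k : ℕ) • b) ≠ 0 := fun k =>
      Finset.prod_ne_zero_iff.mp (right_ne_zero_of_mul hu) k (Finset.mem_univ k)
    have hDu : D u ≠ 0 := by simpa using right_ne_zero_of_mul (hDk 0)
    have hl : MvPolynomial.eval₂ κ (f.val u) P.leadingCoeff ≠ 0 := by
      intro h
      apply left_ne_zero_of_mul hu
      simpa [h] using hEe u hDu
    set q := P.map (MvPolynomial.eval₂Hom κ (f.val u)) with hq
    have hq0 : q ≠ 0 := fun h => hl <| by
      have := congrArg (fun r => r.coeff P.natDegree) h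
      simpa [hq, Polynomial.coeff_map] using this
    have hroot : ∀ k : Fin (d + 1), q.eval (g.val (u + (k : ℕ) • b) j) = 0 := by
      intro k
      rw [hq, Polynomial.eval_map,
        ← val_add_of_mem_periods (f.periods.nsmul_mem hb k) (dom_of_D hDu)
          (dom_of_D (right_ne_zero_of_mul (hDk k)))]
      exact hPall _ (hDk k)
    have hninj : ¬ Function.Injective fun k : Fin (d + 1) => g.val (u + (k : ℕ) • b) j := fun hinj =>
      hq0 <| Polynomial.eq_zero_of_natDegree_lt_card_of_eval_eq_zero q hinj hroot <| by
        rw [Fintype.card_fin]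
        exact Nat.lt_succ_of_le Polynomial.natDegree_map_le
    have hpair : ∀ k k' : Fin (d + 1), k < k' →
        g.val (u + (k : ℕ) • b) j = g.val (u + (k' : ℕ) • b) j → ∏ p ∈ S, Q p u = 0 := by
      intro k k' hkk' h
      refine Finset.prod_eq_zero (i := (k, k')) (by simp [S, hkk']) ?_
      rw [val, val, div_eq_div_iff (left_ne_zero_of_mul (hDk k))
        (left_ne_zero_of_mul (hDk k'))] at h
      simp only [Q]
      linear_combination h
    simp only [Function.Injective, not_forall] at hninj
    obtain ⟨k, k', h, hkk'⟩ := hninj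
    rcases lt_or_gt_of_ne hkk' with hlt | hlt
    · exact hpair k k' hlt h
    · exact hpair k' k hlt h.symm
  have hzero : (fun u => ∏ p ∈ S, Q p u) = 0 := by
    have hEB : (fun u => E u * B u) ≠ 0 := fun h => hB0
      (eq_zero_of_mul_eq_zero hB hE hE0 fun u => by rw [mul_comm]; exact congrFun h u)
    refine eq_zero_of_mul_eq_zero (Finset.analyticOnNhd_fun_prod _ fun p _ => hQ p)
      (hE.mul hB) hEB fun u => ?_
    by_cases hu : E u * B u = 0
    · simp [hu]
    · simp [hprod u hu]
  obtain ⟨⟨k, k'⟩, hp, hQ0⟩ := exists_eq_zero_of_prod_eq_zero S hQ (congrFun hzero)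
  have hlt : (k : ℕ) < k' := by simpa [S] using hp
  refine ⟨k' - k, by omega, by omega, fun _ v => ?_⟩
  have := congrFun hQ0 (v - (k : ℕ) • b)
  have e : v - (k : ℕ) • b + (k' : ℕ) • b = v + ((k' : ℕ) - k) • b := by
    rw [sub_nsmul b hlt.le]; abel
  simp only [Q, e, sub_add_cancel, Pi.zero_apply] at this
  simp only [component]
  linear_combination this

/-- The precomposition of a meromorphic map with an entire surjection. -/
def comp (f : MeromorphicMap n m) (T : (Fin l → ℂ) → (Fin n → ℂ)) (hT : AnalyticOnNhd ℂ T univ)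
    (hs : Function.Surjective T) : MeromorphicMap l m where
  num j u := f.num j (T u)
  den j u := f.den j (T u)
  analytic_num j u _ := (f.analytic_num j _ (mem_univ _)).comp (hT u (mem_univ u))
  analytic_den j u _ := (f.analytic_den j _ (mem_univ _)).comp (hT u (mem_univ u))
  den_ne_zero j h := f.den_ne_zero j <| funext fun v => by
    obtain ⟨u, rfl⟩ := hs v
    exact congrFun h u

theorem mem_periods_comp {f : MeromorphicMap n m} {T : (Fin l → ℂ) → (Fin n → ℂ)}
    {hT : AnalyticOnNhd ℂ T univ} {hs : Function.Surjective T} {b : Fin l → ℂ} {c : Fin n → ℂ}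
    (h : ∀ u, T (u + b) = T u + c) : b ∈ (f.comp T hT hs).periods ↔ c ∈ f.periods := by
  change (∀ j u, f.num j (T u) * f.den j (T (u + b)) = f.den j (T u) * f.num j (T (u + b))) ↔
    ∀ j v, f.num j v * f.den j (v + c) = f.den j v * f.num j (v + c)
  simp only [h]
  exact ⟨fun H j v => by obtain ⟨u, rfl⟩ := hs v; exact H j u, fun H j u => H j (T u)⟩

end Periods

/-! ### Discreteness of the group of periods -/

section Discrete

variable {𝕜 : Type*} [RCLike 𝕜] {n m : ℕ}

/-- The denominators of a meromorphic map do not vanish identically on an open subset of `𝕜ⁿ`. -/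
theorem exists_complexPoint_mem_dom (f : MeromorphicMap n m) {V : Set (Fin n → 𝕜)} (hV : IsOpen V)
    (hne : V.Nonempty) (a : Fin n → 𝕜) : ∃ u ∈ V, complexPoint 𝕜 n (u + a) ∈ f.dom := by
  by_contra! hcon
  have hden : ∀ j, AnalyticOnNhd ℂ (fun u => f.den j (u + complexPoint 𝕜 n a)) univ := fun j =>
    analyticOnNhd_add_const (f.analytic_den j) _
  have := eq_zero_of_complexPoint (Finset.analyticOnNhd_fun_prod Finset.univ fun j _ => hden j)
    hV hne fun u hu => by
      have h := hcon u hu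
      simp only [dom, mem_ofPred_eq, not_forall, not_not] at h
      obtain ⟨j, hj⟩ := h
      rw [map_add] at hj
      exact Finset.prod_eq_zero (Finset.mem_univ j) hj
  obtain ⟨j, -, hj⟩ := exists_eq_zero_of_prod_eq_zero _ hden (congrFun this)
  exact add_const_ne_zero (f.den_ne_zero j) _ hj

theorem isOpen_dom (f : MeromorphicMap n m) : IsOpen f.dom := by
  simp only [dom, ofPred_forall]
  exact isOpen_iInter_of_finite fun j => isOpen_ne_fun
    (continuousOn_univ.mp (f.analytic_den j).continuousOn) continuous_const

theorem analyticAt_val (f : MeromorphicMap n m) {u : Fin n → ℂ} (hu : u ∈ f.dom) :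
    AnalyticAt ℂ f.val u :=
  analyticAt_pi_iff.mpr fun j =>
    (f.analytic_num j u (mem_univ u)).div (f.analytic_den j u (mem_univ u)) (hu j)

/-- Small translations are not periods of a map which is a local diffeomorphism at some point. -/
theorem discreteTopology_periods_of_injective_fderiv (f : MeromorphicMap n n) {p : Fin n → ℂ}
    (hp : p ∈ f.dom) (hinj : Function.Injective (fderiv ℂ f.val p)) :
    DiscreteTopology f.periods := by
  let e := (LinearEquiv.ofInjectiveEndo (fderiv ℂ f.val p : (Fin n → ℂ) →ₗ[ℂ] (Fin n → ℂ))
    hinj).toContinuousLinearEquiv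
  have he : (e : (Fin n → ℂ) →L[ℂ] (Fin n → ℂ)) = fderiv ℂ f.val p := by ext1; rfl
  have hstrict : HasStrictFDerivAt f.val (e : (Fin n → ℂ) →L[ℂ] (Fin n → ℂ)) p := by
    rw [he]; exact (f.analyticAt_val hp).hasStrictFDerivAt
  let h := hstrict.toOpenPartialHomeomorph f.val
  let O : Set (Fin n → ℂ) := (fun b => p + b) ⁻¹' (h.source ∩ f.dom)
  have hO : IsOpen O := (h.open_source.inter f.isOpen_dom).preimage (by fun_prop)
  have hp' : p ∈ h.source := hstrict.mem_toOpenPartialHomeomorph_source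
  refine discreteTopology_of_isOpen_singleton_zero ?_
  convert hO.preimage continuous_subtype_val using 1
  ext b
  refine ⟨?_, fun hb => ?_⟩
  · rintro rfl
    simpa [O] using ⟨hp', hp⟩
  · have := h.injOn hb.1 hp' (val_add_of_mem_periods b.2 hp hb.2)
    exact Subtype.ext (by simpa using this)

/-- The defining equation of a chart induced by `f`, one coordinate at a time, at the points where the
denominator of that coordinate is nonzero. -/
theorem InducesChart.exists_eq_val {f : MeromorphicMap n n}
    {φ : OpenPartialHomeomorph (Fin n → 𝕜) (Fin n → 𝕜)} (h : f.InducesChart φ) :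
    ∃ a : Fin n → 𝕜, ∀ u ∈ φ.source, ∀ j, f.den j (complexPoint 𝕜 n (u + a)) ≠ 0 →
      toComplex 𝕜 (φ u j) = f.val (complexPoint 𝕜 n (u + a)) j := by
  obtain ⟨-, -, -, a, ha⟩ := h
  exact ⟨a, fun u hu j hj => eq_div_of_mul_eq hj (ha u hu j)⟩

theorem InducesChart.discreteTopology_periods {f : MeromorphicMap n n}
    {φ : OpenPartialHomeomorph (Fin n → 𝕜) (Fin n → 𝕜)} (h : f.InducesChart φ) :
    DiscreteTopology f.periods := by
  obtain ⟨a, ha⟩ := h.exists_eq_val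
  obtain ⟨u₀, hu₀, hp⟩ := f.exists_complexPoint_mem_dom φ.open_source ⟨0, h.1⟩ a
  have hφ : HasFDerivAt φ (fderiv 𝕜 φ u₀) u₀ := (h.2.1 u₀ hu₀).differentiableAt.hasFDerivAt
  have hφ' := (h.2.2.1 (φ u₀) (φ.map_source hu₀)).differentiableAt.hasFDerivAt
  set L := fderiv 𝕜 φ u₀
  set L' := fderiv 𝕜 φ.symm (φ u₀)
  have hL : L'.comp L = ContinuousLinearMap.id 𝕜 _ := by
    refine (hφ'.comp u₀ hφ).unique ((hasFDerivAt_id u₀).congr_of_eventuallyEq ?_)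
    filter_upwards [φ.open_source.mem_nhds hu₀] with u hu using φ.left_inv hu
  have hval := (f.analyticAt_val hp).differentiableAt.hasFDerivAt
  set A := fderiv ℂ f.val (complexPoint 𝕜 n (u₀ + a)) with hA
  -- The complex derivative of `f` is the complexification of the derivative of the chart.
  have hAL : (A.restrictScalars ℝ).comp (complexPoint 𝕜 n) =
      (complexPoint 𝕜 n).comp (L.restrictScalars ℝ) := by
    have h1 : HasFDerivAt (fun u : Fin n → 𝕜 => complexPoint 𝕜 n (u + a)) (complexPoint 𝕜 n) u₀ :=
      (complexPoint 𝕜 n).hasFDerivAt.comp u₀ ((hasFDerivAt_id u₀).add_const a)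
    have h2 := (hval.restrictScalars ℝ).comp u₀ h1
    have h3 := (complexPoint 𝕜 n).hasFDerivAt.comp u₀ (hφ.restrictScalars ℝ)
    refine h2.unique (h3.congr_of_eventuallyEq ?_)
    have hc : ContinuousAt (fun u : Fin n → 𝕜 => complexPoint 𝕜 n (u + a)) u₀ := h1.continuousAt
    filter_upwards [φ.open_source.mem_nhds hu₀,
      hc.preimage_mem_nhds (f.isOpen_dom.mem_nhds hp)] with u hu hud
    funext j
    exact (ha u hu j (hud j)).symm
  have hAc : (A : (Fin n → ℂ) →ₗ[ℂ] (Fin n → ℂ)) = complexify (L : (Fin n → 𝕜) →ₗ[𝕜] _) :=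
    eq_complexify fun u => DFunLike.congr_fun hAL u
  have hid : complexify (L' : (Fin n → 𝕜) →ₗ[𝕜] (Fin n → 𝕜)) ∘ₗ
      complexify (L : (Fin n → 𝕜) →ₗ[𝕜] (Fin n → 𝕜)) = LinearMap.id := by
    rw [← complexify_comp, ← complexify_id (𝕜 := 𝕜)]
    exact congrArg complexify (LinearMap.ext fun u => DFunLike.congr_fun hL u)
  refine f.discreteTopology_periods_of_injective_fderiv hp ?_
  change Function.Injective (A : (Fin n → ℂ) →ₗ[ℂ] (Fin n → ℂ))
  rw [hAc]
  exact Function.LeftInverse.injective (g := complexify (L' : (Fin n → 𝕜) →ₗ[𝕜] (Fin n → 𝕜)))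
    fun u => DFunLike.congr_fun hid u

end Discrete

/-! ### Locally Nash isomorphisms -/

section Isomorphisms

variable {𝕜 : Type*} [RCLike 𝕜] {n : ℕ} {f g : MeromorphicMap n n}
  {φ ψ : OpenPartialHomeomorph (Fin n → 𝕜) (Fin n → 𝕜)}

/-- A locally Nash map for the atlases of translates of `φ` and `ψ`, with value `0` at `0`, is near
`0` a Nash map with respect to `ψ` and some translate of `φ`. -/
theorem _root_.IsLocallyNashMap.exists_translate {α : (Fin n → 𝕜) → (Fin n → 𝕜)}
    (hα : IsLocallyNashMap (translateAtlas φ) (translateAtlas ψ) α) (hα0 : α 0 = 0)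
    (hψ : 0 ∈ ψ.source) :
    ∃ (c : Fin n → 𝕜) (U : Set (Fin n → 𝕜)), IsOpen U ∧ 0 ∈ U ∧
      (∀ u ∈ U, -c + u ∈ φ.source ∧ α u ∈ ψ.source) ∧
      IsNashMap 𝕜 (fun x => ψ (α (c + φ.symm x))) ((fun u => φ (-c + u)) '' U) := by
  obtain ⟨_, ⟨c, rfl⟩, U, hU, hUs, h0, hm, hN⟩ := hα.2 0 _ ⟨0, rfl⟩ (by simpa [hα0] using hψ)
  refine ⟨c, U, hU, h0, fun u hu => ⟨by simpa using hUs hu, by simpa using hm hu⟩, ?_⟩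
  simpa [Function.comp_def, Homeomorph.addLeft_symm] using! hN

/-- An additive locally Nash map is `𝕜`-linear: continuity makes it real-linear, and it is its own
derivative at `0`, which is `𝕜`-linear. -/
theorem _root_.IsLocallyNashMap.exists_linearMap {α : (Fin n → 𝕜) →+ (Fin n → 𝕜)}
    (hα : IsLocallyNashMap (translateAtlas φ) (translateAtlas ψ) α) (hf : f.InducesChart φ)
    (hg : g.InducesChart ψ) : ∃ L : (Fin n → 𝕜) →ₗ[𝕜] (Fin n → 𝕜), ∀ u, L u = α u := by
  obtain ⟨c, U, hU, h0, hs, hN⟩ := hα.exists_translate (map_zero α) hg.1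
  have h1 : DifferentiableAt 𝕜 (fun u => φ (-c + u)) 0 :=
    (hf.2.1 _ (hs 0 h0).1).differentiableAt.comp (g := φ) 0
      (differentiableAt_id.const_add (-c))
  have h2 := (hN.analytic _ (mem_image_of_mem (fun u => φ (-c + u)) h0)).differentiableAt
  have e : ∀ u ∈ U, ψ (α (c + φ.symm (φ (-c + u)))) = ψ (α u) := fun u hu => by
    rw [φ.left_inv (hs u hu).1, add_neg_cancel_left]
  have h3 : DifferentiableAt 𝕜 ψ.symm (ψ (α (c + φ.symm (φ (-c + 0))))) := by
    rw [e 0 h0]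
    exact (hg.2.2.1 _ (ψ.map_source (hs 0 h0).2)).differentiableAt
  have h4 : DifferentiableAt 𝕜 α 0 := by
    refine (h3.comp (0 : Fin n → 𝕜) (h2.comp (0 : Fin n → 𝕜) h1)).congr_of_eventuallyEq ?_
    filter_upwards [hU.mem_nhds h0] with u hu
    simp only [Function.comp_apply, e u hu, ψ.left_inv (hs u hu).2]
  refine ⟨fderiv 𝕜 α 0, fun u => ?_⟩
  have := (h4.hasFDerivAt.restrictScalars ℝ).unique (α.toRealLinearMap hα.1).hasFDerivAt
  exact DFunLike.congr_fun this u

/-- A linear locally Nash isomorphism `α : (𝕜ⁿ, +, f) → (𝕜ⁿ, +, g)` maps `M · Λ_f` into `Λ_g`, for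
some `M > 0`. Up to translations, which do not change the periods, the coordinates of `g ∘ α` are
algebraic over `𝕜(f)`. -/
theorem exists_nsmul_complexify_mem_periods (hf : f.GivesLocallyNashGroup φ)
    (hg : g.InducesChart ψ) {L : (Fin n → 𝕜) →ₗ[𝕜] (Fin n → 𝕜)}
    (hL : IsLocallyNashMap (translateAtlas φ) (translateAtlas ψ) L)
    (hs : Function.Surjective (complexify L)) :
    ∃ M : ℕ, 0 < M ∧ ∀ b ∈ f.periods, M • complexify L b ∈ g.periods := by
  obtain ⟨c, U, hU, h0, hUs, hN⟩ := hL.exists_translate (map_zero L) hg.1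
  obtain ⟨a, ha⟩ := hf.inducesChart.exists_eq_val
  obtain ⟨a', ha'⟩ := hg.exists_eq_val
  choose P hPdeg hP using hN.algebraic
  let T : (Fin n → ℂ) → (Fin n → ℂ) := fun u => u + complexPoint 𝕜 n (-c + a)
  let T' : (Fin n → ℂ) → (Fin n → ℂ) := fun u => complexify L u + complexPoint 𝕜 n a'
  have hT : AnalyticOnNhd ℂ T univ := fun u _ => analyticAt_id.add analyticAt_const
  have hTs : Function.Surjective T := add_right_surjective _
  have hT' : AnalyticOnNhd ℂ T' univ := fun u _ =>
    ((LinearMap.toContinuousLinearMap (complexify L)).analyticAt u).add analyticAt_const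
  have hTs' : Function.Surjective T' := (add_right_surjective _).comp hs
  let F := f.comp T hT hTs
  let G := g.comp T' hT' hTs'
  have hFG : ∀ j, ∀ b ∈ F.periods, (P j).natDegree.factorial • b ∈ (G.component j).periods := by
    intro j b hb
    have hlc : ∃ u ∈ F.dom,
        MvPolynomial.eval₂ (toComplex 𝕜) (F.val u) (P j).leadingCoeff ≠ 0 := by
      by_contra! hcon
      have hP0 : P j ≠ 0 := fun h => by simpa [h] using hPdeg j
      refine hP0 (Polynomial.leadingCoeff_eq_zero.mp (hf.admitsAAT.1 _ fun v hv => ?_))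
      obtain ⟨u, rfl⟩ := hTs v
      exact hcon u hv
    obtain ⟨k, hk, hkd, hkb⟩ := exists_nsmul_mem_periods F G j (P j) hlc hU ⟨0, h0⟩
      (fun u hu hF hG => by
        have hx := hP j _ (mem_image_of_mem (fun u => φ (-c + u)) hu)
        simp only [φ.left_inv (hUs u hu).1, add_neg_cancel_left] at hx
        have eT : T (complexPoint 𝕜 n u) = complexPoint 𝕜 n ((-c + u) + a) := by
          simp only [T, ← map_add]; congr 1; abel
        have eT' : T' (complexPoint 𝕜 n u) = complexPoint 𝕜 n (L u + a') := by
          simp only [T', map_add, complexify_complexPoint]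
        have eF : F.val (complexPoint 𝕜 n u) = fun i => toComplex 𝕜 (φ (-c + u) i) := by
          funext i
          change f.val (T (complexPoint 𝕜 n u)) i = _
          rw [eT]
          exact (ha _ (hUs u hu).1 i (eT ▸ hF i)).symm
        have eG : G.val (complexPoint 𝕜 n u) j = toComplex 𝕜 (ψ (L u) j) := by
          change g.val (T' (complexPoint 𝕜 n u)) j = _
          rw [eT']
          exact (ha' _ (hUs u hu).2 j (eT' ▸ hG)).symm
        have hκ := congrArg (toComplex 𝕜) hx
        rw [Polynomial.hom_eval₂, map_zero] at hκ
        rw [eF, eG, ← hκ]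
        congr 1
        ext <;> simp) hb
    obtain ⟨r, hr⟩ := Nat.dvd_factorial hk hkd
    rw [hr, mul_comm, mul_smul]
    exact AddSubgroup.nsmul_mem _ hkb r
  -- `∏ⱼ dⱼ!` is divisible by all the multiples that occur for the separate coordinates.
  refine ⟨∏ j, (P j).natDegree.factorial, Finset.prod_pos fun j _ => Nat.factorial_pos _,
    fun b hb => ?_⟩
  have hbF : b ∈ F.periods := (mem_periods_comp fun u => by simp only [T]; abel).mpr hb
  have hMb : (∏ j, (P j).natDegree.factorial) • b ∈ G.periods := by
    refine mem_periods_iff_component.mpr fun j => ?_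
    rw [← Finset.prod_erase_mul _ _ (Finset.mem_univ j), mul_smul]
    exact AddSubgroup.nsmul_mem _ (hFG j b hbF) _
  refine (mem_periods_comp fun u => ?_).mp hMb
  simp only [T', map_add, map_nsmul]
  abel

theorem rank_periods_le (hf : f.GivesLocallyNashGroup φ) (hg : g.InducesChart ψ)
    {L L' : (Fin n → 𝕜) →ₗ[𝕜] (Fin n → 𝕜)}
    (hL : IsLocallyNashMap (translateAtlas φ) (translateAtlas ψ) L)
    (hLL' : L ∘ₗ L' = LinearMap.id) (hL'L : L' ∘ₗ L = LinearMap.id) :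
    Module.rank ℤ f.periods ≤ Module.rank ℤ g.periods := by
  have hr : Function.RightInverse (complexify L') (complexify L) := fun u => by
    rw [← LinearMap.comp_apply, ← complexify_comp, hLL', complexify_id, LinearMap.id_apply]
  have hl : Function.LeftInverse (complexify L') (complexify L) := fun u => by
    rw [← LinearMap.comp_apply, ← complexify_comp, hL'L, complexify_id, LinearMap.id_apply]
  obtain ⟨M, hM, hMg⟩ := exists_nsmul_complexify_mem_periods hf hg hL hr.surjective
  let θ : f.periods →+ g.periods :=
    { toFun := fun b => ⟨M • complexify L b, hMg b b.2⟩
      map_zero' := by ext1; simp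
      map_add' := fun b b' => by ext1; simp }
  refine LinearMap.rank_le_of_injective θ.toIntLinearMap fun b b' h => Subtype.ext ?_
  have h' : M • complexify L b = M • complexify L b' := congrArg Subtype.val h
  exact hl.injective (nsmul_right_injective hM.ne' h')

end Isomorphisms

end MeromorphicMap

end

theorem mainTheorem6 {𝕜 : Type*} [RCLike 𝕜] {n : ℕ} (f g : MeromorphicMap n n)
    (φ ψ : OpenPartialHomeomorph (Fin n → 𝕜) (Fin n → 𝕜))
    (hf : f.GivesLocallyNashGroup φ) (hg : g.GivesLocallyNashGroup ψ)
    (hiso : LocallyNashIsomorphic (translateAtlas φ) (translateAtlas ψ)) :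
    DiscreteTopology f.periods ∧ DiscreteTopology g.periods ∧
      Module.finrank ℤ f.periods = Module.finrank ℤ g.periods := by
  refine ⟨hf.inducesChart.discreteTopology_periods, hg.inducesChart.discreteTopology_periods, ?_⟩
  obtain ⟨α, hα, hα'⟩ := hiso
  obtain ⟨L, hL⟩ := IsLocallyNashMap.exists_linearMap (α := (α : (Fin n → 𝕜) →+ (Fin n → 𝕜))) hα
    hf.inducesChart hg.inducesChart
  obtain ⟨L', hL'⟩ := IsLocallyNashMap.exists_linearMap
    (α := (α.symm : (Fin n → 𝕜) →+ (Fin n → 𝕜))) hα' hg.inducesChart hf.inducesChart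
  have eL : (L : (Fin n → 𝕜) → (Fin n → 𝕜)) = α := funext hL
  have eL' : (L' : (Fin n → 𝕜) → (Fin n → 𝕜)) = α.symm := funext hL'
  have h1 : L ∘ₗ L' = LinearMap.id := LinearMap.ext fun u => by simp [eL, eL']
  have h2 : L' ∘ₗ L = LinearMap.id := LinearMap.ext fun u => by simp [eL, eL']
  have hrank : Module.rank ℤ f.periods = Module.rank ℤ g.periods := le_antisymm
    (MeromorphicMap.rank_periods_le hf hg.inducesChart (eL ▸ hα) h1 h2)
    (MeromorphicMap.rank_periods_le hg hf.inducesChart (eL' ▸ hα') h2 h1)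
  rw [Module.finrank, Module.finrank, hrank]
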